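/- Let $(R,\mathfrak m)$ be a commutative Noetherian local ring, $I$ an ideal of $R$ with $\dim R/I = 1$, $M$ an arbitrary $R$-module and $n\ge 0$ an integer. For a prime $\mathfrak p$ of $R$, let $\mu^i(\mathfrak p,M)=\dim_{k(\mathfrak p)}\operatorname{Ext}^i_{R_{\mathfrak p}}(k(\mathfrak p),M_{\mathfrak p})$, where $k(\mathfrak p)=R_{\mathfrak p}/\mathfrak pR_{\mathfrak p}$, denote the $i$-th Bass number of $M$ at $\mathfrak p$, and call an $R$-module $L$ minimax if it has a finitely generated submodule $N$ such that $L/N$ is Artinian. Write $V(I)$ for the set of prime ideals of $R$ containing $I$. Then the following conditions are equivalent: (i) $\mu^i(\mathfrak p,M)$ is finite for all $\mathfrak p\in V(I)$ and all $0\le i\le n$; (ii) $\operatorname{Ext}^i_R(R/I,M)$ is minimax for all $0\le i\le n$. -/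

import Mathlib

open CategoryTheory Abelian

universe u

/-- An `R`-module `M` is minimax if it has a finitely generated submodule `N` such that
`M / N` is Artinian. -/
def IsMinimax (R : Type*) [CommRing R] (M : Type*) [AddCommGroup M] [Module R M] : Prop :=
  ∃ N : Submodule R M, N.FG ∧ IsArtinian R (M ⧸ N)

/-- The maximal ideal of a local ring `A` with residue field `k` annihilates `Ext_A^i(k, N)`. -/
theorem isTorsionBySet_ext_residueField (A : Type u) [CommRing A] [IsLocalRing A]
    (N : ModuleCat.{u} A) (i : ℕ) :
    Module.IsTorsionBySet A
      (Ext (ModuleCat.of A (IsLocalRing.ResidueField A)) N i)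
      (IsLocalRing.maximalIdeal A : Set A) := by
  rintro x ⟨a, ha⟩
  have h0 : a • 𝟙 (ModuleCat.of A (IsLocalRing.ResidueField A)) = 0 := by
    ext y
    have h1 : IsLocalRing.residue A a = 0 := (IsLocalRing.residue_eq_zero_iff a).2 ha
    have h2 : a • y = 0 := by
      rw [Algebra.smul_def]
      exact (congrArg (· * y) h1).trans (zero_mul y)
    exact h2
  have h3 : a • x = (Ext.mk₀ (a • 𝟙 (ModuleCat.of A (IsLocalRing.ResidueField A)))).comp x
      (zero_add i) := by
    rw [Ext.mk₀_smul, Ext.smul_comp, Ext.mk₀_id_comp]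
  change a • x = 0
  rw [h3, h0, Ext.mk₀_zero, Ext.zero_comp]

/-- For a local ring `A` with residue field `k`, the `A`-module `Ext_A^i(k, N)` is annihilated by
the maximal ideal, hence is a `k`-vector space with scalar multiplication `[a] • x = a • x`. -/
noncomputable instance extResidueFieldModule (A : Type u) [CommRing A] [IsLocalRing A]
    (N : ModuleCat.{u} A) (i : ℕ) :
    Module (IsLocalRing.ResidueField A)
      (Ext (ModuleCat.of A (IsLocalRing.ResidueField A)) N i) :=
  (isTorsionBySet_ext_residueField A N i).module

/-- The `k`-vector space structure on `Ext_A^i(k, N)` is compatible with the `A`-module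
structure. -/
theorem residue_smul_ext (A : Type u) [CommRing A] [IsLocalRing A]
    (N : ModuleCat.{u} A) (i : ℕ) (a : A)
    (x : Ext (ModuleCat.of A (IsLocalRing.ResidueField A)) N i) :
    IsLocalRing.residue A a • x = a • x :=
  rfl

/-- The `i`-th Bass number `μ^i(p, M)`, a cardinal: the dimension over `k(p) = R_p / p R_p` of
`Ext_{R_p}^i(k(p), M_p)`. -/
noncomputable def bassNumber {R : Type u} [CommRing R] (i : ℕ) (p : PrimeSpectrum R)
    (M : Type u) [AddCommGroup M] [Module R M] : Cardinal.{u} :=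
  Module.rank (IsLocalRing.ResidueField (Localization.AtPrime p.asIdeal))
    (Ext
      (ModuleCat.of (Localization.AtPrime p.asIdeal)
        (IsLocalRing.ResidueField (Localization.AtPrime p.asIdeal)))
      (ModuleCat.of (Localization.AtPrime p.asIdeal)
        (LocalizedModule p.asIdeal.primeCompl M)) i)

/-! Since `Ext` with finite first argument commutes with localization over a Noetherian ring, and
`k(p)` is `R/p` localized at `p`, the number `μ^i(p, M)` is finite exactly when `E = Ext^i(R/p, M)`
is generated by a finite submodule up to torsion by elements outside `p`
(`bassNumber_lt_aleph0_iff`). Everything then happens over `R`.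

(i) ⇒ (ii), degree by degree: a prime filtration of `R/I` reduces to `E` with `I ≤ p`. If `p = 𝔪`,
then `E` is finite. Otherwise take `x ∈ 𝔪 \ p`. Only `𝔪` contains `p + (x)`, so the kernel of `x` on
`E`, a quotient of `Ext^i(R/(p + (x)), M)`, is finite and Artinian. If the finite submodule `N`
generates `E` up to torsion, then `E/N` is `x`-power torsion and its `x`-kernel is Artinian, whence
`E/N` is Artinian (`isArtinian_of_isArtinian_ker_lsmul`).

(ii) ⇒ (i): induction on the degree gives minimaxness of `Ext^i(N, M)` for all finite `N` killed by
`I` (`IsExactClosed.ext_of_le_annihilator`). For `N = R/p`, the Artinian quotient is torsion outside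
`p` when `p ≠ 𝔪`, and finite when `p = 𝔪`. -/

/-! ### Minimax modules and exact sequences. -/

section Minimax

variable {R : Type*} [CommRing R]

/-- Over a Noetherian ring, the middle term of an exact sequence with minimax outer terms is
minimax. -/
theorem IsMinimax.of_exact [IsNoetherianRing R] {L₁ L₂ L₃ : Type*} [AddCommGroup L₁] [Module R L₁]
    [AddCommGroup L₂] [Module R L₂] [AddCommGroup L₃] [Module R L₃] {f : L₁ →ₗ[R] L₂}
    {g : L₂ →ₗ[R] L₃} (hfg : Function.Exact f g) (h₁ : IsMinimax R L₁) (h₃ : IsMinimax R L₃) :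
    IsMinimax R L₂ := by
  obtain ⟨N₁, hN₁, hA₁⟩ := h₁
  obtain ⟨N₃, hN₃, hA₃⟩ := h₃
  have hfg3 : (N₃ ⊓ LinearMap.range g).FG := by
    have := isNoetherian_of_fg_of_noetherian N₃ hN₃
    exact Submodule.FG.of_le hN₃ inf_le_left
  obtain ⟨F, hF, hFg⟩ : ∃ F : Submodule R L₂, F.FG ∧ F.map g = N₃ ⊓ LinearMap.range g := by
    obtain ⟨s, hs⟩ := hfg3
    have hsub (y : s) : ∃ x, g x = y :=
      (hs ▸ Submodule.subset_span y.2 : (y : L₃) ∈ N₃ ⊓ LinearMap.range g).2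
    choose r hr using hsub
    refine ⟨Submodule.span R (Set.range r), Submodule.fg_span (Set.finite_range r), ?_⟩
    rw [Submodule.map_span, ← Set.range_comp, show g ∘ r = Subtype.val from funext hr,
      Subtype.range_coe_subtype, ← hs]
    rfl
  refine ⟨N₁.map f ⊔ F, (hN₁.map f).sup hF, ?_⟩
  have h1 : N₁ ≤ (N₁.map f ⊔ F).comap f := fun x hx ↦
    Submodule.mem_sup_left (Submodule.mem_map_of_mem hx)
  have h2 : N₁.map f ⊔ F ≤ N₃.comap g := by
    rw [sup_le_iff]
    refine ⟨?_, fun x hx ↦ (hFg.le (Submodule.mem_map_of_mem hx)).1⟩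
    rintro _ ⟨x, -, rfl⟩
    simp [hfg.apply_apply_eq_zero]
  refine isArtinian_of_range_eq_ker (Submodule.mapQ _ _ f h1) (Submodule.mapQ _ _ g h2) ?_
  refine le_antisymm ?_ ?_
  · rintro _ ⟨x, rfl⟩
    induction x using Submodule.Quotient.induction_on with | _ x
    simp [hfg.apply_apply_eq_zero]
  · intro y hy
    induction y using Submodule.Quotient.induction_on with | _ y
    have hy' : g y ∈ N₃ := by simpa using hy
    obtain ⟨z, hz, hzy⟩ : g y ∈ F.map g := hFg ▸ ⟨hy', y, rfl⟩
    obtain ⟨x, hx⟩ := (hfg (y - z)).1 (by rw [map_sub, hzy, sub_self])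
    refine ⟨Submodule.Quotient.mk x, ?_⟩
    rw [Submodule.mapQ_apply, hx]
    refine (Submodule.Quotient.eq _).2 ?_
    have : y - z - y = -z := by abel
    rw [this]
    exact neg_mem (Submodule.mem_sup_right hz)

/-- A finite module is minimax. -/
theorem IsMinimax.of_finite {L : Type*} [AddCommGroup L] [Module R L] [Module.Finite R L] :
    IsMinimax R L :=
  ⟨⊤, Module.Finite.fg_top, inferInstance⟩

end Minimax

/-! ### Artinian criteria through the kernel of one element. -/

section Artinian

variable {R : Type*} [CommRing R]

/-- A module all of whose elements are killed by powers of `x` is Artinian as soon as the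
submodule of elements killed by `x` is. -/
theorem isArtinian_of_isArtinian_ker_lsmul {L : Type*} [AddCommGroup L] [Module R L] (x : R)
    (htors : ∀ y : L, ∃ k : ℕ, x ^ k • y = 0)
    (hker : IsArtinian R (LinearMap.ker (LinearMap.lsmul R L x))) : IsArtinian R L := by
  let S := LinearMap.ker (LinearMap.lsmul R L x)
  -- `A N k` is `x ^ k N ∩ S`. As `L` is `x`-power torsion, these layers detect equality of nested
  -- submodules.
  let A : Submodule R L → ℕ → Submodule R S := fun N k ↦
    (N.map (LinearMap.lsmul R L (x ^ k))).comap S.subtype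
  have hA_mem {N k} {s : S} : s ∈ A N k ↔ ∃ y ∈ N, x ^ k • y = s := by
    simp [A, Submodule.mem_map]
  have hA_mono {N N' : Submodule R L} (h : N ≤ N') (k) : A N k ≤ A N' k := fun s hs ↦ by
    obtain ⟨y, hy, hs⟩ := hA_mem.1 hs
    exact hA_mem.2 ⟨y, h hy, hs⟩
  have hA_anti (N : Submodule R L) : Antitone (A N) := by
    refine antitone_nat_of_succ_le fun k s hs ↦ ?_
    obtain ⟨y, hy, hs⟩ := hA_mem.1 hs
    exact hA_mem.2 ⟨x • y, N.smul_mem _ hy, by rw [← hs, pow_succ, mul_smul]⟩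
  rw [← monotone_stabilizes_iff_artinian]
  intro f
  -- stabilisation along the diagonal
  obtain ⟨n, hn⟩ := IsArtinian.monotone_stabilizes (R := R) (M := S)
    ⟨fun j ↦ OrderDual.toDual (A (OrderDual.ofDual (f j)) j), fun a b hab ↦
      OrderDual.toDual_le_toDual.2
        ((hA_anti _ hab).trans (hA_mono (OrderDual.ofDual_le_ofDual.2 (f.mono hab)) _))⟩
  have hcol (k : ℕ) : ∃ m, ∀ j, m ≤ j → A (OrderDual.ofDual (f m)) k =
      A (OrderDual.ofDual (f j)) k := by
    obtain ⟨m, hm⟩ := IsArtinian.monotone_stabilizes (R := R) (M := S)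
      ⟨fun j ↦ OrderDual.toDual (A (OrderDual.ofDual (f j)) k), fun a b hab ↦
        OrderDual.toDual_le_toDual.2 (hA_mono (OrderDual.ofDual_le_ofDual.2 (f.mono hab)) _)⟩
    exact ⟨m, fun j hj ↦ hm j hj⟩
  choose m hm using hcol
  -- The diagonal controls all layers `k ≥ n`; the sum exceeds each of the finitely many remaining
  -- bounds `m k`.
  let q := n + ∑ k ∈ Finset.range n, m k
  have hnq : n ≤ q := Nat.le_add_right _ _
  have key (j : ℕ) (hj : q ≤ j) (k : ℕ) :
      A (OrderDual.ofDual (f q)) k ≤ A (OrderDual.ofDual (f j)) k := by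
    by_cases hk : k < n
    · have : m k ≤ q := (Finset.single_le_sum (fun _ _ ↦ Nat.zero_le _)
        (Finset.mem_range.2 hk)).trans (Nat.le_add_left _ _)
      rw [← hm k q this, ← hm k j (this.trans hj)]
    · push Not at hk
      have hJ : A (OrderDual.ofDual (f n)) n =
        A (OrderDual.ofDual (f (max j k))) (max j k) := hn _ ((hnq.trans hj).trans (le_max_left _ _))
      calc _ ≤ A (OrderDual.ofDual (f n)) n :=
            (hA_anti _ hk).trans (hA_mono (OrderDual.ofDual_le_ofDual.2 (f.mono hnq)) _)
        _ ≤ _ := hJ.le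
        _ ≤ _ := (hA_anti _ (le_max_right j k)).trans
            (hA_mono (OrderDual.ofDual_le_ofDual.2 (f.mono (le_max_left j k))) _)
  refine ⟨q, fun j hj ↦ le_antisymm (f.mono hj) ?_⟩
  change OrderDual.ofDual (f q) ≤ OrderDual.ofDual (f j)
  -- If `x ^ (k + 1)` kills `y`, then `x ^ k • y` lies in layer `k`, so it equals `x ^ k • z` with
  -- `z` in the smaller module, and `x ^ k` kills `y - z`.
  have main (k : ℕ) : ∀ y ∈ OrderDual.ofDual (f q), x ^ k • y = 0 → y ∈ OrderDual.ofDual (f j) := by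
    induction k with
    | zero => intro y _ h; rw [pow_zero, one_smul] at h; rw [h]; exact zero_mem _
    | succ k ih =>
      intro y hy h
      have hs : x ^ k • y ∈ S := by
        change x • x ^ k • y = 0
        rw [smul_smul, ← pow_succ', h]
      obtain ⟨z, hz, hzy⟩ := hA_mem.1 (key j hj k (hA_mem.2 ⟨y, hy, rfl⟩ : (⟨_, hs⟩ : S) ∈ _))
      have h1 := ih (y - z) (sub_mem hy ((OrderDual.ofDual_le_ofDual.2 (f.mono hj)) hz))
        (by rw [smul_sub, hzy, sub_self])
      simpa using add_mem h1 hz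
  intro y hy
  obtain ⟨k, hk⟩ := htors y
  exact main k y hy hk

/-- A finite module killed by an ideal all of whose prime overideals are maximal is Artinian. -/
theorem isArtinian_of_le_annihilator [IsNoetherianRing R] {L : Type*} [AddCommGroup L] [Module R L]
    [Module.Finite R L] (J : Ideal R) (hJ : ∀ q : Ideal R, q.IsPrime → J ≤ q → q.IsMaximal)
    (hL : J ≤ Module.annihilator R L) : IsArtinian R L := by
  have : Ring.KrullDimLE 0 (R ⧸ J) := .mk₀ fun q hq ↦ by
    have h := hJ (q.comap (Ideal.Quotient.mk J)) inferInstance fun a ha ↦ by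
      rw [Ideal.mem_comap, Ideal.Quotient.eq_zero_iff_mem.2 ha]; exact zero_mem _
    rw [← Ideal.map_comap_of_surjective _ Ideal.Quotient.mk_surjective q]
    exact (Ideal.map_eq_top_or_isMaximal_of_surjective _ Ideal.Quotient.mk_surjective h).resolve_left
      (by rw [Ideal.map_comap_of_surjective _ Ideal.Quotient.mk_surjective q]; exact hq.ne_top)
  have : IsArtinianRing (R ⧸ J) :=
    isArtinianRing_iff_isNoetherianRing_krullDimLE_zero.2 ⟨inferInstance, inferInstance⟩
  have hT : Module.IsTorsionBySet R L J := fun y a ↦ Module.mem_annihilator.1 (hL a.2) y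
  let _ : Module (R ⧸ J) L := hT.module
  have : IsScalarTower R (R ⧸ J) L := hT.isScalarTower
  have : Module.Finite (R ⧸ J) L := Module.Finite.of_restrictScalars_finite R _ _
  exact isArtinian_of_surjective_algebraMap (S := R) (R := R ⧸ J) Ideal.Quotient.mk_surjective

/-- A minimax module over a Noetherian ring which is killed by a maximal ideal is finite. -/
theorem IsMinimax.finite_of_le_annihilator [IsNoetherianRing R] {L : Type*} [AddCommGroup L]
    [Module R L] (h : IsMinimax R L) (q : Ideal R) [q.IsMaximal]
    (hL : q ≤ Module.annihilator R L) : Module.Finite R L := by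
  obtain ⟨N, hN, hA⟩ := h
  have hT : Module.IsTorsionBySet R (L ⧸ N) q := fun y a ↦ by
    induction y using Submodule.Quotient.induction_on with | _ y
    rw [← Submodule.Quotient.mk_smul, Module.mem_annihilator.1 (hL a.2) y,
      Submodule.Quotient.mk_zero]
  let _ : Module (R ⧸ q) (L ⧸ N) := hT.module
  have : IsScalarTower R (R ⧸ q) (L ⧸ N) := hT.isScalarTower
  have _ : IsArtinian (R ⧸ q) (L ⧸ N) := isArtinian_of_tower R inferInstance
  have : IsSemisimpleRing (R ⧸ q) :=
    let _ : Field (R ⧸ q) := Ideal.Quotient.field q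
    inferInstance
  have : Module.Finite (R ⧸ q) (L ⧸ N) := 
    ((IsSemisimpleModule.finite_tfae (R := R ⧸ q) (M := L ⧸ N)).out 0 2).mpr ‹_›
  have : Module.Finite R (L ⧸ N) := Module.Finite.trans (R ⧸ q) _
  have : Module.Finite R N := Module.Finite.iff_fg.2 hN
  exact Module.Finite.of_submodule_quotient N

/-- Suppose that `x` acts on `E` with finite kernel, that `E` is killed by `p`, that the primes
containing `p` and `x` are maximal, and that `E` is generated by a finite submodule up to
`x`-power torsion. Then `E` is minimax. -/
theorem isMinimax_of_finite_ker [IsNoetherianRing R] {E : Type*} [AddCommGroup E] [Module R E]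
    (p : Ideal R) (x : R) (hp : p ≤ Module.annihilator R E)
    (hmax : ∀ q : Ideal R, q.IsPrime → p ⊔ Ideal.span {x} ≤ q → q.IsMaximal)
    (hker : Module.Finite R (LinearMap.ker (LinearMap.lsmul R E x)))
    (N : Submodule R E) (hN : N.FG) (hNt : ∀ e : E, ∃ k : ℕ, x ^ k • e ∈ N) :
    IsMinimax R E := by
  refine ⟨N, hN, isArtinian_of_isArtinian_ker_lsmul x (fun y ↦ ?_) ?_⟩
  · induction y using Submodule.Quotient.induction_on with | _ y
    obtain ⟨k, hk⟩ := hNt y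
    exact ⟨k, by rw [← Submodule.Quotient.mk_smul]; exact (Submodule.Quotient.mk_eq_zero _).2 hk⟩
  have hNfin : Module.Finite R N := Module.Finite.iff_fg.2 hN
  have hann {L : Type _} [AddCommGroup L] [Module R L] (h1 : ∀ a ∈ p, ∀ y : L, a • y = 0)
      (h2 : ∀ y : L, x • y = 0) : p ⊔ Ideal.span {x} ≤ Module.annihilator R L := by
    rw [sup_le_iff, Ideal.span_singleton_le_iff_mem]
    exact ⟨fun a ha ↦ Module.mem_annihilator.2 (h1 a ha), Module.mem_annihilator.2 h2⟩
  have hpE (a : R) (ha : a ∈ p) (y : E) : a • y = 0 := Module.mem_annihilator.1 (hp ha) y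
  -- the preimage of the `x`-torsion of `E ⧸ N`
  let T : Submodule R E := N.comap (LinearMap.lsmul R E x)
  let Q := N ⧸ (LinearMap.range (LinearMap.lsmul R N x))
  have hQ : IsArtinian R Q := isArtinian_of_le_annihilator _ hmax (hann
    (fun a ha y ↦ by
      induction y using Submodule.Quotient.induction_on with | _ y
      rw [← Submodule.Quotient.mk_smul, show a • y = 0 from Subtype.ext (hpE a ha y),
        Submodule.Quotient.mk_zero])
    (fun y ↦ by
      induction y using Submodule.Quotient.induction_on with | _ y
      exact (Submodule.Quotient.mk_eq_zero _).2 ⟨y, rfl⟩))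
  have hK : IsArtinian R (LinearMap.ker (LinearMap.lsmul R E x)) :=
    isArtinian_of_le_annihilator _ hmax (hann (fun a ha y ↦ Subtype.ext (hpE a ha y))
      (fun y ↦ Subtype.ext y.2))
  let K' := LinearMap.ker (LinearMap.lsmul R (E ⧸ N) x)
  have hsub : LinearMap.ker (LinearMap.lsmul R E x) ≤ T := fun y hy ↦ by
    change x • y ∈ N
    rw [show x • y = 0 from hy]; exact zero_mem _
  -- Multiplication by `x` descends along `π` to the snake map `K' → N/xN`, whose kernel is the
  -- image of the kernel of `x` on `E`. Thus `K'` sits between two Artinian modules.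
  let g : T →ₗ[R] Q := (Submodule.mkQ _).comp ((LinearMap.lsmul R E x).restrict (fun y hy ↦ hy))
  let π : T →ₗ[R] K' := (N.mkQ.restrict (p := T) (q := K') fun y hy ↦ by
    change x • N.mkQ y = 0
    rw [← map_smul]
    exact (Submodule.Quotient.mk_eq_zero _).2 hy)
  have hπ : Function.Surjective π := by
    rintro ⟨y, hy⟩
    induction y using Submodule.Quotient.induction_on with | _ y
    exact ⟨⟨y, (Submodule.Quotient.mk_eq_zero N).1 hy⟩, rfl⟩
  have hπg : LinearMap.ker π ≤ LinearMap.ker g := by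
    rintro ⟨y, hy⟩ h
    have hyN : y ∈ N := (Submodule.Quotient.mk_eq_zero N).1 (congrArg Subtype.val h)
    exact (Submodule.Quotient.mk_eq_zero _).2 ⟨⟨y, hyN⟩, rfl⟩
  let e := π.quotKerEquivOfSurjective hπ
  let g' : K' →ₗ[R] Q := ((LinearMap.ker π).liftQ g hπg).comp e.symm.toLinearMap
  have hg' (t : T) : g' (π t) = g t := by
    have : e.symm (π t) = Submodule.Quotient.mk t := by
      rw [LinearEquiv.symm_apply_eq]; rfl
    simp only [g', LinearMap.comp_apply, LinearEquiv.coe_coe, this]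
    rfl
  refine isArtinian_of_range_eq_ker (π.comp (Submodule.inclusion hsub)) g' (le_antisymm ?_ ?_)
  · rintro _ ⟨y, rfl⟩
    change g' (π _) = 0
    rw [hg']
    refine (Submodule.Quotient.mk_eq_zero _).2 ⟨0, ?_⟩
    rw [map_zero]
    exact Subtype.ext (show (0 : E) = x • (y : E) from y.2.symm)
  · intro z hz
    obtain ⟨t, rfl⟩ := hπ z
    have : g t = 0 := (hg' t).symm.trans hz
    obtain ⟨w, hw⟩ := (Submodule.Quotient.mk_eq_zero _).1 this
    have hw' : x • (w : E) = x • (t : E) := congrArg Subtype.val hw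
    refine ⟨⟨(t : E) - w, ?_⟩, ?_⟩
    · change x • ((t : E) - w) = 0
      rw [smul_sub, hw', sub_self]
    · refine Subtype.ext ?_
      change (Submodule.Quotient.mk ((t : E) - w) : E ⧸ N) = Submodule.Quotient.mk (t : E)
      refine (Submodule.Quotient.eq _).2 ?_
      rw [show (t : E) - w - t = -w by abel]
      exact neg_mem w.2

end Artinian

/-! ### Dévissage for `Ext` in the first variable. -/

section Ext

variable {R : Type u} [CommRing R]

/-- A property of modules which passes to the middle term of an exact sequence. -/
def IsExactClosed (P : ∀ (L : Type u) [AddCommGroup L] [Module R L], Prop) : Prop :=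
  (∀ (L : Type u) [AddCommGroup L] [Module R L] [Subsingleton L], P L) ∧
    ∀ (L₁ L₂ L₃ : Type u) [AddCommGroup L₁] [AddCommGroup L₂] [AddCommGroup L₃] [Module R L₁]
      [Module R L₂] [Module R L₃] (f : L₁ →ₗ[R] L₂) (g : L₂ →ₗ[R] L₃),
      Function.Exact f g → P L₁ → P L₃ → P L₂

/-- Letting an outer term vanish, exact-closedness also covers submodules and quotients. -/
theorem isExactClosed_isMinimax [IsNoetherianRing R] :
    IsExactClosed (R := R) fun L _ _ ↦ IsMinimax R L :=
  ⟨fun _ _ _ _ ↦ .of_finite, fun _ _ _ _ _ _ _ _ _ _ _ h h₁ h₃ ↦ .of_exact h h₁ h₃⟩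

theorem isExactClosed_finite [IsNoetherianRing R] :
    IsExactClosed (R := R) fun L _ _ ↦ Module.Finite R L :=
  ⟨fun _ _ _ _ ↦ inferInstance, fun L₁ L₂ L₃ _ _ _ _ _ _ f g h _ _ ↦ by
    have := isNoetherian_of_range_eq_ker f g (LinearMap.exact_iff.1 h).symm
    infer_instance⟩

theorem IsExactClosed.of_linearEquiv {P : ∀ (L : Type u) [AddCommGroup L] [Module R L], Prop}
    (hP : IsExactClosed (R := R) P) {L L' : Type u} [AddCommGroup L] [AddCommGroup L'] [Module R L]
    [Module R L'] (e : L ≃ₗ[R] L') (h : P L) : P L' :=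
  hP.2 L L' PUnit e.toLinearMap 0
    (fun y ↦ ⟨fun _ ↦ ⟨e.symm y, e.apply_symm_apply y⟩, fun _ ↦ rfl⟩) h (hP.1 _)

/-- A linear equivalence in the first argument induces a linear equivalence of `Ext`-modules. -/
noncomputable def extLinearEquivOfIsoLeft {X X' : ModuleCat.{u} R} (e : X ≅ X') (Y : ModuleCat.{u} R)
    (i : ℕ) : Ext X Y i ≃ₗ[R] Ext X' Y i :=
  LinearEquiv.ofLinearMap
    ((Ext.mk₀ e.inv).precompOfLinear R Y (zero_add i))
    ((Ext.mk₀ e.hom).precompOfLinear R Y (zero_add i))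
    (by ext x; simp)
    (by ext x; simp)

theorem exact_ext_contravariant {S : ShortComplex (ModuleCat.{u} R)} (hS : S.ShortExact)
    (Y : ModuleCat.{u} R) (i : ℕ) :
    Function.Exact ((Ext.mk₀ S.g).precompOfLinear R Y (zero_add i))
      ((Ext.mk₀ S.f).precompOfLinear R Y (zero_add i)) := fun x ↦
  ⟨fun hx ↦ Ext.contravariant_sequence_exact₂ hS Y x hx, by
    rintro ⟨y, rfl⟩
    simp⟩

theorem exact_ext_contravariant_extClass {S : ShortComplex (ModuleCat.{u} R)} (hS : S.ShortExact)
    (Y : ModuleCat.{u} R) {i j : ℕ} (hij : 1 + i = j) :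
    Function.Exact (hS.extClass.precompOfLinear R Y hij)
      ((Ext.mk₀ S.g).precompOfLinear R Y (zero_add j)) := fun x ↦
  ⟨fun hx ↦ Ext.contravariant_sequence_exact₃ hS Y x hx hij, by
    rintro ⟨y, rfl⟩
    simp⟩

/-- The short exact sequence of modules attached to an exact sequence of linear maps. -/
theorem shortExact_moduleCatMk {N₁ N₂ N₃ : Type u} [AddCommGroup N₁] [AddCommGroup N₂]
    [AddCommGroup N₃] [Module R N₁] [Module R N₂] [Module R N₃] (f : N₁ →ₗ[R] N₂) (g : N₂ →ₗ[R] N₃)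
    (hf : Function.Injective f) (hg : Function.Surjective g) (hfg : Function.Exact f g) :
    (ShortComplex.moduleCatMk f g hfg.linearMap_comp_eq_zero).ShortExact :=
  ModuleCat.shortComplex_shortExact _ hfg hf hg

/-- Dévissage along a prime filtration. -/
theorem IsExactClosed.ext_of_isPrime [IsNoetherianRing R]
    {P : ∀ (L : Type u) [AddCommGroup L] [Module R L], Prop} (hP : IsExactClosed (R := R) P)
    (Y : ModuleCat.{u} R) (i : ℕ) (J : Ideal R)
    (h : ∀ q : Ideal R, q.IsPrime → J ≤ q → P (Ext (ModuleCat.of R (R ⧸ q)) Y i))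
    (N : Type u) [AddCommGroup N] [Module R N] [Module.Finite R N]
    (hN : J ≤ Module.annihilator R N) : P (Ext (ModuleCat.of R N) Y i) := by
  induction ‹Module.Finite R N› using IsNoetherianRing.induction_on_isQuotientEquivQuotientPrime R with
  | subsingleton N =>
    have : Subsingleton (Ext (ModuleCat.of R N) Y i) :=
      subsingleton_of_forall_eq 0 fun x ↦ by
        rw [← Ext.mk₀_id_comp x, (ModuleCat.isZero_of_subsingleton (ModuleCat.of R N)).eq_of_src
          (𝟙 (ModuleCat.of R N)) 0, Ext.mk₀_zero, Ext.zero_comp]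
    exact hP.1 _
  | quotient N q e =>
    refine hP.of_linearEquiv (extLinearEquivOfIsoLeft e.symm.toModuleIso Y i) (h q.1 q.2 ?_)
    rwa [e.annihilator_eq, Ideal.annihilator_quotient] at hN
  | exact N₁ N₂ N₃ f g hf hg hfg h₁ h₃ =>
    exact hP.2 _ _ _ _ _ (exact_ext_contravariant (shortExact_moduleCatMk f g hf hg hfg) Y i)
      (h₃ (hN.trans (LinearMap.annihilator_le_of_surjective g hg)))
      (h₁ (hN.trans (LinearMap.annihilator_le_of_injective f hf)))

/-- If `Ext^i(R/I, Y)` belongs to an exact-closed class for all `i ≤ n`, then so does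
`Ext^i(N, Y)` for every finite module `N` killed by `I`. -/
theorem IsExactClosed.ext_of_le_annihilator [IsNoetherianRing R]
    {P : ∀ (L : Type u) [AddCommGroup L] [Module R L], Prop} (hP : IsExactClosed (R := R) P)
    (Y : ModuleCat.{u} R) (I : Ideal R) (n : ℕ)
    (h : ∀ i ≤ n, P (Ext (ModuleCat.of R (R ⧸ I)) Y i)) (i : ℕ) (hi : i ≤ n)
    (N : Type u) [AddCommGroup N] [Module R N] [Module.Finite R N]
    (hN : I ≤ Module.annihilator R N) : P (Ext (ModuleCat.of R N) Y i) := by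
  induction i generalizing N with
  | zero =>
    refine hP.ext_of_isPrime Y 0 I (fun q _ hq ↦ ?_) N hN
    let g : R ⧸ I →ₗ[R] R ⧸ q := Submodule.factor hq
    have : Epi (ModuleCat.ofHom g) :=
      (ModuleCat.epi_iff_surjective _).2 (Submodule.factor_surjective hq)
    refine hP.2 PUnit _ _ 0 ((Ext.mk₀ (ModuleCat.ofHom g)).precompOfLinear R Y (zero_add 0))
      (fun x ↦ ⟨fun hx ↦ ⟨0, ?_⟩, ?_⟩) (hP.1 _) (h 0 hi)
    · exact (Ext.precomp_mk₀_injective_of_epi Y (ModuleCat.ofHom g)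
        (hx.trans (map_zero _).symm)).symm
    · rintro ⟨y, rfl⟩
      simp
  | succ i ih =>
    -- For cyclic `R/q` the kernel `K` of `R/I → R/q` is finite and killed by `I`, so
    -- `Ext^(i+1)(R/q, Y)` lies between `Ext^i(K, Y)` and `Ext^(i+1)(R/I, Y)`.
    refine hP.ext_of_isPrime Y (i + 1) I (fun q _ hq ↦ ?_) N hN
    let g : R ⧸ I →ₗ[R] R ⧸ q := Submodule.factor hq
    have hS := shortExact_moduleCatMk (LinearMap.ker g).subtype g Subtype.val_injective
      (Submodule.factor_surjective hq) (LinearMap.exact_subtype_ker_map g)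
    refine hP.2 _ _ _ _ _ (exact_ext_contravariant_extClass hS Y (add_comm 1 i))
      (ih (Nat.le_of_succ_le hi) _ ?_) (h (i + 1) hi)
    exact (Ideal.annihilator_quotient (I := I)).ge.trans
      (LinearMap.annihilator_le_of_injective _ (LinearMap.ker g).subtype_injective)

theorem annihilator_le_annihilator_ext {N : Type u} [AddCommGroup N] [Module R N]
    (Y : ModuleCat.{u} R) (i : ℕ) :
    Module.annihilator R N ≤ Module.annihilator R (Ext (ModuleCat.of R N) Y i) := fun a ha ↦
  Module.mem_annihilator.2 fun x ↦ by
    have h0 : a • 𝟙 (ModuleCat.of R N) = 0 := by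
      ext y
      exact Module.mem_annihilator.1 ha y
    rw [← Ext.mk₀_id_comp x, ← Ext.smul_comp, ← Ext.mk₀_smul, h0, Ext.mk₀_zero, Ext.zero_comp]

open Pointwise in
/-- If `x` is regular on `N`, the kernel of `x` on `Ext^i(N, Y)` is a quotient of
`Ext^i(N/xN, Y)`. -/
theorem finite_ker_lsmul_ext {N : Type u} [AddCommGroup N] [Module R N] (x : R)
    (hx : IsSMulRegular N x) (Y : ModuleCat.{u} R) (i : ℕ)
    (h : Module.Finite R (Ext (ModuleCat.of R (N ⧸ (x • (⊤ : Submodule R N)))) Y i)) :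
    Module.Finite R (LinearMap.ker (LinearMap.lsmul R (Ext (ModuleCat.of R N) Y i) x)) := by
  have hS : ((ModuleCat.of R N).smulShortComplex x).ShortExact :=
    IsSMulRegular.smulShortComplex_shortExact hx
  have hf (y : Ext (ModuleCat.of R N) Y i) :
      (Ext.mk₀ ((ModuleCat.of R N).smulShortComplex x).f).comp y (zero_add i) = x • y := by
    refine (congrArg (fun a ↦ Ext.comp a y (zero_add i)) (Ext.mk₀_smul x (𝟙 _))).trans ?_
    rw [Ext.smul_comp, Ext.mk₀_id_comp]
  let g : Ext (ModuleCat.of R (N ⧸ (x • (⊤ : Submodule R N)))) Y i →ₗ[R] Ext (ModuleCat.of R N) Y i :=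
    (Ext.mk₀ ((ModuleCat.of R N).smulShortComplex x).g).precompOfLinear R Y (zero_add i)
  have hg : LinearMap.ker (LinearMap.lsmul R (Ext (ModuleCat.of R N) Y i) x) = LinearMap.range g :=
    LinearMap.exact_iff.1 fun y ↦ by
      refine Iff.trans ?_ (exact_ext_contravariant hS Y i y)
      rw [LinearMap.lsmul_apply, ← hf y]
      rfl
  rw [hg]
  exact Module.Finite.range g

end Ext

/-! ### Localization of `Ext`. -/

section Localization

variable {R : Type u} [CommRing R]

open ModuleCat

/-- Scaling is composition with `r • 𝟙 Y`, so only degree zero needs checking. -/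
theorem mapExactFunctor_localized_smul (S : Submonoid R) {X Y : ModuleCat.{u} R} {n : ℕ} (r : R)
    (x : Ext X Y n) :
    (r • x).mapExactFunctor (localizedModuleFunctor.{u} S) =
      algebraMap R (Localization S) r • x.mapExactFunctor (localizedModuleFunctor.{u} S) := by
  have h : (localizedModuleFunctor.{u} S).map (r • 𝟙 Y) =
      algebraMap R (Localization S) r • 𝟙 ((localizedModuleFunctor.{u} S).obj Y) := by
    ext y
    have h1 := map_smul (IsLocalizedModule.mapExtendScalars S (Y.localizedModuleMkLinearMap S)
      (Y.localizedModuleMkLinearMap S) (Localization S)) r (𝟙 Y : Y ⟶ Y).hom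
    have h2 := LinearMap.congr_fun
      (congrArg ModuleCat.Hom.hom ((localizedModuleFunctor.{u} S).map_id Y)) y
    refine (LinearMap.congr_fun h1 y).trans ?_
    refine (congrArg (fun z : Y.localizedModule S ↦ r • z) h2).trans ?_
    exact (algebraMap_smul (Localization S) r (M := Y.localizedModule S) y).symm
  rw [Ext.smul_eq_comp_mk₀, Ext.mapExactFunctor_comp, Ext.mapExactFunctor_mk₀, h,
    ← Ext.smul_eq_comp_mk₀]

/-- `Ext` commutes with localization in the first finite variable: every element of the
localized `Ext` is a fraction, and the kernel of the localization map is `S`-torsion. -/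
theorem mapExactFunctor_localized [IsNoetherianRing R] (S : Submonoid R) (X Y : ModuleCat.{u} R)
    [Module.Finite R X] (n : ℕ) :
    (∀ y : Ext ((localizedModuleFunctor.{u} S).obj X) ((localizedModuleFunctor.{u} S).obj Y) n,
      ∃ s ∈ S, ∃ x : Ext X Y n, algebraMap R (Localization S) s • y =
        x.mapExactFunctor (localizedModuleFunctor.{u} S)) ∧
    ∀ x : Ext X Y n, x.mapExactFunctor (localizedModuleFunctor.{u} S) = 0 →
      ∃ s ∈ S, s • x = 0 := by
  induction n generalizing Y with
  | zero =>
    have := Module.finitePresentation_of_finite R X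
    have hloc : IsLocalizedModule S (IsLocalizedModule.mapExtendScalars S
      (X.localizedModuleMkLinearMap S) (Y.localizedModuleMkLinearMap S) (Localization S)) :=
      inferInstance
    constructor
    · intro y
      obtain ⟨y, rfl⟩ := (Ext.mk₀_bijective _ _).2 y
      obtain ⟨⟨x, s⟩, hx⟩ := hloc.surj y.hom
      refine ⟨s, s.2, Ext.mk₀ (ModuleCat.ofHom x), ?_⟩
      rw [Ext.mapExactFunctor_mk₀, ← Ext.mk₀_smul]
      congr 1
      ext z
      refine Eq.trans ?_ (LinearMap.congr_fun hx z)
      exact algebraMap_smul (Localization S) (s : R) (M := Y.localizedModule S) (y.hom z)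
    · intro x hx
      obtain ⟨x, rfl⟩ := (Ext.mk₀_bijective _ _).2 x
      rw [Ext.mapExactFunctor_mk₀] at hx
      have hx' := (Ext.mk₀_bijective _ _).1 (hx.trans (Ext.mk₀_zero _ _).symm)
      obtain ⟨s, hs⟩ := hloc.exists_of_eq (x₁ := x.hom) (x₂ := 0)
        ((congrArg ModuleCat.Hom.hom hx').trans (map_zero _).symm)
      refine ⟨s, s.2, ?_⟩
      rw [← Ext.mk₀_smul, ← Ext.mk₀_zero]
      congr 1
      ext z
      have h1 : (s : R) • x.hom z = (s : R) • (0 : X →ₗ[R] Y) z := LinearMap.congr_fun hs z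
      rw [LinearMap.zero_apply, smul_zero] at h1
      exact h1
  | succ n ih =>
    let F := localizedModuleFunctor.{u} S
    let I : InjectivePresentation Y := Classical.arbitrary _
    let T := ShortComplex.mk _ _ (Limits.cokernel.condition I.f)
    have hT : T.ShortExact := { exact := ShortComplex.exact_cokernel I.f }
    have : Injective T.X₂ := I.injective
    -- Localization over a Noetherian ring preserves injectives, so dimension shifting works both
    -- before and after localizing.
    have : Injective (T.map F).X₂ :=
      Functor.PreservesInjectiveObjects.injective_obj (F := F) I.injective
    obtain ⟨δ, hδ, hsurj, hexact⟩ : ∃ δ : Ext (F.obj T.X₃) (F.obj T.X₁) 1,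
        hT.extClass.mapExactFunctor F = δ ∧
        (∀ y : Ext (F.obj X) (F.obj T.X₁) (n + 1), ∃ z, y = Ext.comp z δ rfl) ∧
        ∀ z : Ext (F.obj X) (F.obj T.X₃) n, Ext.comp z δ (rfl : n + 1 = n + 1) = 0 →
          ∃ v : Ext (F.obj X) (F.obj T.X₂) n, z = v.comp (Ext.mk₀ (F.map T.g)) (add_zero n) := by
      refine ⟨(hT.map_of_exact F).extClass, Ext.mapExactFunctor_extClass F hT, fun y ↦ ?_,
        fun z hz ↦ ?_⟩
      · obtain ⟨z, hz⟩ := Ext.covariant_sequence_exact₁ _ (hT.map_of_exact F) y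
          (Ext.eq_zero_of_injective _) rfl
        exact ⟨z, hz.symm⟩
      · obtain ⟨v, hv⟩ := Ext.covariant_sequence_exact₃ _ (hT.map_of_exact F) z rfl hz
        exact ⟨v, hv.symm⟩
    constructor
    · intro y
      obtain ⟨z, rfl⟩ := hsurj y
      obtain ⟨s, hs, w, hw⟩ := (ih T.X₃).1 z
      refine ⟨s, hs, w.comp hT.extClass rfl, ?_⟩
      rw [Ext.mapExactFunctor_comp, ← hw, hδ, Ext.smul_comp]
    · intro x hx
      obtain ⟨w, rfl⟩ := Ext.covariant_sequence_exact₁ _ hT x (Ext.eq_zero_of_injective _) rfl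
      rw [Ext.mapExactFunctor_comp, hδ] at hx
      obtain ⟨v, hv⟩ := hexact _ hx
      obtain ⟨s, hs, v', hv'⟩ := (ih T.X₂).1 v
      -- Clearing the denominator of `v` gives a class that localizes to zero. Its correction term
      -- comes from `T.X₂`, so it dies under the connecting map.
      obtain ⟨t, ht, h⟩ := (ih T.X₃).2 (s • w - v'.comp (Ext.mk₀ T.g) (add_zero n)) (by
        rw [← Functor.mapExtAddHom_apply, map_sub, Functor.mapExtAddHom_apply,
          Functor.mapExtAddHom_apply, mapExactFunctor_localized_smul, Ext.mapExactFunctor_comp,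
          Ext.mapExactFunctor_mk₀, ← hv', Ext.smul_comp, hv, sub_self])
      refine ⟨t * s, mul_mem ht hs, ?_⟩
      rw [smul_sub, sub_eq_zero, smul_smul] at h
      rw [← Ext.smul_comp, h, Ext.smul_comp, Ext.comp_assoc_of_second_deg_zero,
        hT.comp_extClass, Ext.comp_zero, smul_zero]

/-- The localization of `Ext^n(X, Y)` at `S` is finite if and only if `Ext^n(X, Y)` is, up to
`S`-torsion, generated by a finite submodule. -/
theorem finite_localized_ext_iff [IsNoetherianRing R] (S : Submonoid R) (X Y : ModuleCat.{u} R)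
    [Module.Finite R X] (n : ℕ) :
    Module.Finite (Localization S)
      (Ext ((localizedModuleFunctor.{u} S).obj X) ((localizedModuleFunctor.{u} S).obj Y) n) ↔
    ∃ N : Submodule R (Ext X Y n), N.FG ∧ ∀ e, ∃ s ∈ S, s • e ∈ N := by
  obtain ⟨h1, h2⟩ := mapExactFunctor_localized S X Y n
  set φ := (localizedModuleFunctor.{u} S).mapExtAddHom X Y n with hφ
  have hsmul (r : R) (x : Ext X Y n) : φ (r • x) = algebraMap R (Localization S) r • φ x :=
    mapExactFunctor_localized_smul S r x
  have hunit (s : R) (hs : s ∈ S) : IsUnit (algebraMap R (Localization S) s) :=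
    IsLocalization.map_units _ (⟨s, hs⟩ : S)
  constructor
  · rintro ⟨t, ht⟩
    choose s hs x hx using h1
    refine ⟨Submodule.span R (x '' t), Submodule.fg_span (t.finite_toSet.image x), ?_⟩
    have key (y) (hy : y ∈ Submodule.span (Localization S) (t : Set (Ext
        ((localizedModuleFunctor.{u} S).obj X) ((localizedModuleFunctor.{u} S).obj Y) n))) :
        ∃ a ∈ S, ∃ z ∈ Submodule.span R (x '' t), algebraMap R (Localization S) a • y = φ z := by
      induction hy using Submodule.span_induction with
      | mem y hy => exact ⟨s y, hs y, x y, Submodule.subset_span ⟨y, hy, rfl⟩, hx y⟩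
      | zero => exact ⟨1, one_mem _, 0, zero_mem _, by rw [smul_zero, map_zero]⟩
      | add y y' _ _ ih ih' =>
        obtain ⟨a, ha, z, hz, h⟩ := ih
        obtain ⟨a', ha', z', hz', h'⟩ := ih'
        refine ⟨a * a', mul_mem ha ha', a' • z + a • z',
          add_mem (Submodule.smul_mem _ _ hz) (Submodule.smul_mem _ _ hz'), ?_⟩
        rw [map_add, hsmul, hsmul, ← h, ← h', smul_smul, smul_smul, smul_add, map_mul,
          mul_comm (algebraMap R _ a')]
      | smul b y _ ih =>
        obtain ⟨a, ha, z, hz, h⟩ := ih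
        obtain ⟨⟨c, d⟩, hcd⟩ := IsLocalization.surj S b
        refine ⟨d * a, mul_mem d.2 ha, c • z, Submodule.smul_mem _ _ hz, ?_⟩
        rw [hsmul, ← h, smul_smul, smul_smul, ← hcd, map_mul]
        congr 1
        ring
    intro e
    obtain ⟨a, ha, z, hz, h⟩ := key (φ e) (by rw [ht]; trivial)
    obtain ⟨b, hb, h'⟩ := h2 (a • e - z) (by
      rw [← Functor.mapExtAddHom_apply, ← hφ, map_sub, hsmul, h, sub_self])
    refine ⟨b * a, mul_mem hb ha, ?_⟩
    rw [smul_sub, sub_eq_zero, smul_smul] at h'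
    rw [h']
    exact Submodule.smul_mem _ _ hz
  · rintro ⟨N, ⟨t, rfl⟩, hN⟩
    classical
    refine ⟨t.image φ, ?_⟩
    rw [eq_top_iff]
    have key (z) (hz : z ∈ Submodule.span R (t : Set (Ext X Y n))) :
        φ z ∈ Submodule.span (Localization S) (t.image φ : Set (Ext
          ((localizedModuleFunctor.{u} S).obj X) ((localizedModuleFunctor.{u} S).obj Y) n)) := by
      induction hz using Submodule.span_induction with
      | mem y hy => exact Submodule.subset_span (Finset.mem_image_of_mem φ hy)
      | zero => rw [map_zero]; exact zero_mem _
      | add y y' _ _ ih ih' => rw [map_add]; exact add_mem ih ih'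
      | smul b y _ ih => rw [hsmul]; exact Submodule.smul_mem _ _ ih
    intro y _
    obtain ⟨s, hs, x, hx⟩ := h1 y
    obtain ⟨s', hs', hx'⟩ := hN x
    rw [← Submodule.smul_mem_iff_of_isUnit _ (hunit (s' * s) (mul_mem hs' hs)), map_mul, mul_smul,
      hx, ← Functor.mapExtAddHom_apply, ← hφ, ← hsmul]
    exact key _ hx'

end Localization

/-! ### Bass numbers expressed by `Ext` over `R`. -/

section BassNumber

variable {R : Type u} [CommRing R]

/-- A linear equivalence in the second argument induces a linear equivalence of `Ext`-modules. -/
noncomputable def extLinearEquivOfIsoRight (X : ModuleCat.{u} R) {Y Y' : ModuleCat.{u} R} (e : Y ≅ Y')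
    (i : ℕ) : Ext X Y i ≃ₗ[R] Ext X Y' i :=
  LinearEquiv.ofLinearMap
    ((Ext.mk₀ e.hom).postcompOfLinear R X (add_zero i))
    ((Ext.mk₀ e.inv).postcompOfLinear R X (add_zero i))
    (by ext x; simp)
    (by ext x; simp)

/-- The image of `R \ p` in the domain `R/p` is the set of nonzero elements, so localizing yields
its fraction field. -/
theorem isLocalizedModule_residueField (p : Ideal R) [p.IsPrime] :
    IsLocalizedModule p.primeCompl
      (IsScalarTower.toAlgHom R (R ⧸ p) p.ResidueField).toLinearMap := by
  rw [isLocalizedModule_iff_isLocalization]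
  have : Algebra.algebraMapSubmonoid (R ⧸ p) p.primeCompl = nonZeroDivisors (R ⧸ p) := by
    ext x
    obtain ⟨x, rfl⟩ := Ideal.Quotient.mk_surjective x
    rw [mem_nonZeroDivisors_iff_ne_zero, ne_eq, Ideal.Quotient.eq_zero_iff_mem]
    constructor
    · rintro ⟨y, hy, h⟩ hx
      have h' : Ideal.Quotient.mk p y = 0 := h.trans (Ideal.Quotient.eq_zero_iff_mem.2 hx)
      exact hy (Ideal.Quotient.eq_zero_iff_mem.1 h')
    · exact fun hx ↦ ⟨x, hx, rfl⟩
  rw [this]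
  infer_instance

/-- Any localization of `M` is isomorphic to the one given by `ModuleCat.localizedModuleFunctor`. -/
noncomputable def localizedModuleFunctorObjIso (S : Submonoid R) (M : ModuleCat.{u} R) {N : Type u}
    [AddCommGroup N] [Module R N] [Module (Localization S) N] [IsScalarTower R (Localization S) N]
    (f : M →ₗ[R] N) [IsLocalizedModule S f] :
    (ModuleCat.localizedModuleFunctor.{u} S).obj M ≅ ModuleCat.of (Localization S) N :=
  LinearEquiv.toModuleIso (X₁ := M.localizedModule S)
    ((IsLocalizedModule.linearEquiv S (M.localizedModuleMkLinearMap S)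
      f).extendScalarsOfIsLocalization S (Localization S))

theorem bassNumber_lt_aleph0_iff_finite (i : ℕ) (p : PrimeSpectrum R) (M : Type u) [AddCommGroup M]
    [Module R M] : bassNumber i p M < Cardinal.aleph0 ↔
      Module.Finite (Localization.AtPrime p.asIdeal)
        (Ext (ModuleCat.of (Localization.AtPrime p.asIdeal)
          (IsLocalRing.ResidueField (Localization.AtPrime p.asIdeal)))
          (ModuleCat.of (Localization.AtPrime p.asIdeal)
            (LocalizedModule p.asIdeal.primeCompl M)) i) := by
  unfold bassNumber
  have : IsScalarTower (Localization.AtPrime p.asIdeal)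
      (IsLocalRing.ResidueField (Localization.AtPrime p.asIdeal))
      (Ext (ModuleCat.of (Localization.AtPrime p.asIdeal)
        (IsLocalRing.ResidueField (Localization.AtPrime p.asIdeal)))
        (ModuleCat.of (Localization.AtPrime p.asIdeal)
          (LocalizedModule p.asIdeal.primeCompl M)) i) :=
    IsScalarTower.of_algebraMap_smul fun a x ↦ residue_smul_ext _ _ i a x
  rw [Module.rank_lt_aleph0_iff]
  exact ⟨fun _ ↦ Module.Finite.trans (IsLocalRing.ResidueField (Localization.AtPrime p.asIdeal)) _,
    fun _ ↦ Module.Finite.of_restrictScalars_finite (Localization.AtPrime p.asIdeal) _ _⟩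

/-- The Bass number `μ^i(p, M)` is finite if and only if `Ext^i(R/p, M)` is generated by a
finite submodule up to torsion by elements outside `p`. -/
theorem bassNumber_lt_aleph0_iff [IsNoetherianRing R] (i : ℕ) (p : PrimeSpectrum R) (M : Type u)
    [AddCommGroup M] [Module R M] : bassNumber i p M < Cardinal.aleph0 ↔
      ∃ N : Submodule R (Ext (ModuleCat.of R (R ⧸ p.asIdeal)) (ModuleCat.of R M) i),
        N.FG ∧ ∀ e, ∃ s ∈ p.asIdeal.primeCompl, s • e ∈ N := by
  rw [bassNumber_lt_aleph0_iff_finite, ← finite_localized_ext_iff]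
  have := isLocalizedModule_residueField p.asIdeal
  have e := (extLinearEquivOfIsoLeft (localizedModuleFunctorObjIso p.asIdeal.primeCompl
      (ModuleCat.of R (R ⧸ p.asIdeal))
      (IsScalarTower.toAlgHom R (R ⧸ p.asIdeal) p.asIdeal.ResidueField).toLinearMap) _ i).trans
    (extLinearEquivOfIsoRight _ (localizedModuleFunctorObjIso p.asIdeal.primeCompl (ModuleCat.of R M)
      (LocalizedModule.mkLinearMap p.asIdeal.primeCompl M)) i)
  exact ⟨fun _ ↦ Module.Finite.equiv e.symm, fun _ ↦ Module.Finite.equiv e⟩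

end BassNumber

/-! ### Dimension one and the equivalence. -/

section Main

variable {R : Type u} [CommRing R]

/-- In dimension at most one each prime of `R/I` is minimal or maximal, and `q/I` is not minimal. -/
theorem isMaximal_of_lt_of_ringKrullDim_quotient_eq_one {I p q : Ideal R}
    (hI : ringKrullDim (R ⧸ I) = 1) [hp : p.IsPrime] [hq : q.IsPrime] (hIp : I ≤ p) (hpq : p < q) :
    q.IsMaximal := by
  have hdim : Ring.KrullDimLE 1 (R ⧸ I) := Ring.krullDimLE_iff.2 hI.le
  have hmk := Ideal.Quotient.mk_surjective (I := I)
  have hcomap {r : Ideal R} (hr : I ≤ r) :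
      (r.map (Ideal.Quotient.mk I)).comap (Ideal.Quotient.mk I) = r := by
    rw [Ideal.comap_map_of_surjective _ hmk, ← RingHom.ker_eq_comap_bot, Ideal.mk_ker,
      sup_eq_left.2 hr]
  have hprime {r : Ideal R} (h : r.IsPrime) (hr : I ≤ r) :
      (r.map (Ideal.Quotient.mk I)).IsPrime :=
    Ideal.map_isPrime_of_surjective hmk (by rwa [Ideal.mk_ker])
  have hIq := hIp.trans hpq.le
  rcases Ring.krullDimLE_one_iff.1 hdim _ (hprime hq hIq) with h | h
  · have h1 := h.2 ⟨hprime hp hIp, bot_le⟩ (Ideal.map_mono hpq.le)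
    have h2 := Ideal.comap_mono (f := Ideal.Quotient.mk I) h1
    rw [hcomap hIp, hcomap hIq] at h2
    exact absurd h2 hpq.not_ge
  · rw [← hcomap hIq]
    exact Ideal.comap_isMaximal_of_surjective _ hmk

/-- On the cyclic module `Ry` the powers of `s` stabilize: `s ^ k • y = s ^ (k + 1) • r • y`, and `1
- s * r` is a unit. -/
theorem exists_pow_smul_eq_zero_of_isArtinian {L : Type*} [IsNoetherianRing R] [IsLocalRing R]
    [AddCommGroup L] [Module R L] [IsArtinian R L] {s : R} (hs : s ∈ IsLocalRing.maximalIdeal R)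
    (y : L) : ∃ k : ℕ, s ^ k • y = 0 := by
  obtain ⟨k, ⟨z, hz⟩, hk⟩ := IsArtinian.exists_pow_succ_smul_dvd s
    (⟨y, Submodule.mem_span_singleton_self y⟩ : Submodule.span R {y})
  obtain ⟨r, rfl⟩ := Submodule.mem_span_singleton.1 hz
  have hk' : s ^ (k + 1) • r • y = s ^ k • y := congrArg Subtype.val hk
  refine ⟨k, ?_⟩
  have hu : IsUnit (1 - s * r) := by
    by_contra h
    have h1 := add_mem ((IsLocalRing.mem_maximalIdeal _).2 h) (Ideal.mul_mem_right r _ hs)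
    rw [sub_add_cancel] at h1
    exact (Ideal.ne_top_iff_one _).1 (IsLocalRing.maximalIdeal.isMaximal R).ne_top h1
  rw [← hu.smul_eq_zero, sub_smul, one_smul, sub_eq_zero]
  refine hk'.symm.trans ?_
  rw [smul_smul, smul_smul]
  congr 1
  ring

/-- For a prime `p ≠ 𝔪`, minimax modules are finite up to torsion outside `p`; for `p = 𝔪` this
holds for those killed by `𝔪`. -/
theorem IsMinimax.exists_fg_smul_mem [IsNoetherianRing R] [IsLocalRing R] {L : Type*}
    [AddCommGroup L] [Module R L] (h : IsMinimax R L) (p : Ideal R) [hp : p.IsPrime]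
    (hL : p ≤ Module.annihilator R L) :
    ∃ N : Submodule R L, N.FG ∧ ∀ e, ∃ s ∈ p.primeCompl, s • e ∈ N := by
  by_cases hmax : p.IsMaximal
  · have := h.finite_of_le_annihilator p hL
    exact ⟨⊤, Module.Finite.fg_top, fun e ↦ ⟨1, one_mem _, trivial⟩⟩
  obtain ⟨N, hN, hA⟩ := h
  have hlt : ¬ IsLocalRing.maximalIdeal R ≤ p := fun hle ↦
    hmax ((IsLocalRing.maximalIdeal.isMaximal R).eq_of_le hp.ne_top hle ▸
      IsLocalRing.maximalIdeal.isMaximal R)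
  obtain ⟨s, hs, hsp⟩ := SetLike.not_le_iff_exists.1 hlt
  refine ⟨N, hN, fun e ↦ ?_⟩
  obtain ⟨k, hk⟩ := exists_pow_smul_eq_zero_of_isArtinian hs (Submodule.Quotient.mk e : L ⧸ N)
  refine ⟨s ^ k, pow_mem (S := p.primeCompl) hsp k, ?_⟩
  rwa [← Submodule.Quotient.mk_smul, Submodule.Quotient.mk_eq_zero] at hk

/-- If every prime containing `p` and `s` contains `x`, then every element of a module killed
by `p` that is multiplied into `N` by `s` is multiplied into `N` by a power of `x`. -/
theorem exists_pow_smul_mem_of_mem_radical {L : Type*} [AddCommGroup L] [Module R L] {p : Ideal R}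
    (hL : p ≤ Module.annihilator R L) {s x : R} (hx : x ∈ (p ⊔ Ideal.span {s}).radical)
    {N : Submodule R L} {e : L} (he : s • e ∈ N) : ∃ k : ℕ, x ^ k • e ∈ N := by
  obtain ⟨k, hk⟩ := hx
  obtain ⟨a, ha, b, hb, hab⟩ := Submodule.mem_sup.1 hk
  obtain ⟨c, rfl⟩ := Ideal.mem_span_singleton'.1 hb
  refine ⟨k, ?_⟩
  rw [← hab, add_smul, Module.mem_annihilator.1 (hL ha) e, zero_add, mul_smul]
  exact N.smul_mem c he

open Pointwise in
/-- `Ext^i(R/p, Y)` is minimax for a one-dimensional prime `p` if `Ext^i(R/𝔪, Y)` is finite and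
`Ext^i(R/p, Y)` is finite up to torsion outside `p`. -/
theorem isMinimax_ext_quotient [IsNoetherianRing R] [IsLocalRing R] (Y : ModuleCat.{u} R) (i : ℕ)
    (p : Ideal R) [hp : p.IsPrime] (hpmax : ∀ q : Ideal R, q.IsPrime → p < q → q.IsMaximal)
    (hfin : Module.Finite R (Ext (ModuleCat.of R (R ⧸ IsLocalRing.maximalIdeal R)) Y i))
    (h : ∃ N : Submodule R (Ext (ModuleCat.of R (R ⧸ p)) Y i),
      N.FG ∧ ∀ e, ∃ s ∈ p.primeCompl, s • e ∈ N) :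
    IsMinimax R (Ext (ModuleCat.of R (R ⧸ p)) Y i) := by
  by_cases hm : IsLocalRing.maximalIdeal R ≤ p
  · obtain rfl := (IsLocalRing.maximalIdeal.isMaximal R).eq_of_le hp.ne_top hm
    exact .of_finite
  obtain ⟨x, hxm, hxp⟩ := SetLike.not_le_iff_exists.1 hm
  obtain ⟨N, hN, hNt⟩ := h
  have hann : p ≤ Module.annihilator R (Ext (ModuleCat.of R (R ⧸ p)) Y i) :=
    Ideal.annihilator_quotient.ge.trans (annihilator_le_annihilator_ext Y i)
  have hlt {a : R} (ha : a ∉ p) {q : Ideal R} (hq : p ⊔ Ideal.span {a} ≤ q) : p < q :=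
    lt_of_le_of_ne (le_sup_left.trans hq) fun h ↦ ha
      (h.ge ((le_sup_right.trans hq) (Ideal.mem_span_singleton_self a)))
  have hmax (q : Ideal R) (hq : q.IsPrime) (hle : p ⊔ Ideal.span {x} ≤ q) : q.IsMaximal :=
    hpmax q hq (hlt hxp hle)
  refine isMinimax_of_finite_ker p x hann hmax ?_ N hN fun e ↦ ?_
  · refine finite_ker_lsmul_ext x ?_ Y i ?_
    · refine isSMulRegular_iff_right_eq_zero_of_smul.2 fun y hy ↦ ?_
      obtain ⟨y, rfl⟩ := Ideal.Quotient.mk_surjective y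
      have : x * y ∈ p := Ideal.Quotient.eq_zero_iff_mem.1 hy
      exact Ideal.Quotient.eq_zero_iff_mem.2 ((hp.mem_or_mem this).resolve_left hxp)
    · refine isExactClosed_finite.ext_of_isPrime Y i (p ⊔ Ideal.span {x}) (fun q hq hle ↦ ?_) _ ?_
      · obtain rfl := IsLocalRing.eq_maximalIdeal (hmax q hq hle)
        exact hfin
      · rw [sup_le_iff, Ideal.span_singleton_le_iff_mem]
        refine ⟨Ideal.annihilator_quotient.ge.trans (LinearMap.annihilator_le_of_surjective
          (Submodule.mkQ _) (Submodule.mkQ_surjective _)), Module.mem_annihilator.2 fun y ↦ ?_⟩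
        induction y using Submodule.Quotient.induction_on with | _ y
        rw [← Submodule.Quotient.mk_smul, Submodule.Quotient.mk_eq_zero]
        exact Submodule.smul_mem_pointwise_smul y x ⊤ trivial
  -- The multiplier `s` varies with `e`, but only `𝔪` contains `p + (s)`, so the fixed `x` lies in
  -- its radical.
  · obtain ⟨s, hs, hse⟩ := hNt e
    refine exists_pow_smul_mem_of_mem_radical hann ?_ hse
    rw [Ideal.radical_eq_sInf, Submodule.mem_sInf]
    rintro q ⟨hle, hq⟩
    rwa [IsLocalRing.eq_maximalIdeal (hpmax q hq (hlt hs hle))]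

theorem theorem2p3 {R : Type u} [CommRing R] [IsNoetherianRing R] [IsLocalRing R]
    (I : Ideal R) (hI : ringKrullDim (R ⧸ I) = 1)
    (M : Type u) [AddCommGroup M] [Module R M] (n : ℕ) :
    (∀ p ∈ PrimeSpectrum.zeroLocus (I : Set R), ∀ i ≤ n,
        bassNumber i p M < Cardinal.aleph0) ↔
      ∀ i ≤ n, IsMinimax R (Ext (ModuleCat.of R (R ⧸ I)) (ModuleCat.of R M) i) := by
  simp_rw [bassNumber_lt_aleph0_iff]
  constructor
  · intro h i hi
    have hIm : I ≤ IsLocalRing.maximalIdeal R := IsLocalRing.le_maximalIdeal <| by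
      rintro rfl
      rw [ringKrullDim_eq_bot_of_subsingleton] at hI
      exact absurd hI (by decide)
    have hfin : Module.Finite R
        (Ext (ModuleCat.of R (R ⧸ IsLocalRing.maximalIdeal R)) (ModuleCat.of R M) i) := by
      obtain ⟨N, hN, hNt⟩ := h (IsLocalRing.closedPoint R) hIm i hi
      -- Elements outside `𝔪` are units, so here "up to torsion" is no relaxation.
      refine ⟨(eq_top_iff.2 fun e _ ↦ ?_ : N = ⊤) ▸ hN⟩
      obtain ⟨s, hs, hse⟩ := hNt e
      have hs' : IsUnit s := by
        by_contra hs'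
        exact hs ((IsLocalRing.mem_maximalIdeal _).2 hs')
      exact (N.smul_mem_iff_of_isUnit hs').1 hse
    refine isExactClosed_isMinimax.ext_of_isPrime (ModuleCat.of R M) i I (fun p hp hIp ↦ ?_) _
      Ideal.annihilator_quotient.ge
    exact isMinimax_ext_quotient _ i p
      (fun q hq hpq ↦ isMaximal_of_lt_of_ringKrullDim_quotient_eq_one hI hIp hpq) hfin
      (h ⟨p, hp⟩ hIp i hi)
  · intro h p hp i hi
    have hle : I ≤ p.asIdeal := hp
    refine IsMinimax.exists_fg_smul_mem ?_ p.asIdeal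
      (Ideal.annihilator_quotient.ge.trans (annihilator_le_annihilator_ext _ i))
    exact isExactClosed_isMinimax.ext_of_le_annihilator (ModuleCat.of R M) I n h i hi _
      (hle.trans Ideal.annihilator_quotient.ge)

end Main
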